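/- All spaces are Tychonoff. A set $C\subset X$ is regularly closed if $C=\overline{\operatorname{Int} C}$. Consider functions $\rho(x,C)\in[0,\infty)$ of a point $x\in X$ and a regularly closed set $C\subset X$, and the conditions - K1) $\rho(x,C)=0$ iff $x\in C$; - K1)$^*$ for every $C$ there is a dense open subset $V$ of $X\setminus C$ such that $\rho(x,C)>0$ iff $x\in V$; - K2) if $C\subset C'$ then $\rho(x,C')\le\rho(x,C)$ for all $x$; - K3) $\rho(\cdot,C)$ is continuous for every $C$; - K4) $\rho(x,\overline{\bigcup_\alpha C_\alpha})=\inf_\alpha\rho(x,C_\alpha)$ for all $x$ and every non-empty increasing transfinite (i.e. well-ordered) family $\{C_\alpha\}$ of regularly closed sets; - K5) $\rho(x,C)\le\rho(x,C')+\sup_{y\in C'}\rho(y,C)$ for all $x$ and all regularly closed $C,C'$ (supremum in $[0,\infty]$). The space $X$ is $\kappa$-metrizable if it admits a $\rho$ with K1)–K4), quasi $\kappa$-metrizable if it admits a $\rho$ with K1)$^*$, K2)–K4), and regularly quasi $\kappa$-metrizable if it admits a $\rho$ with K1)$^*$, K2)–K5). An absolute of $X$ is an extremally disconnected space $Z$ together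 with a perfect surjection $f:Z\to X$ that is irreducible, i.e. $f(F)\neq X$ for every proper closed subset $F$ of $Z$. **Corollary 3.7 (with Remark 3.8).** 1. Every space $X$ has an absolute. 2. If $X$ is quasi $\kappa$-metrizable (resp., regularly quasi $\kappa$-metrizable), then so is every absolute of $X$. 3. If $X$ is an infinite compact $\kappa$-metrizable space, then every absolute of $X$ is quasi $\kappa$-metrizable but not $\kappa$-metrizable. 4. Consequently, the $\kappa$-metrizable spaces form a proper subclass of the quasi $\kappa$-metrizable spaces: every $\kappa$-metrizable space is quasi $\kappa$-metrizable, and there is a quasi $\kappa$-metrizable space that is not $\kappa$-metrizable. -/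

import Mathlib

open Set Topology
open scoped NNReal ENNReal

universe u

/-- A regularly closed set: the closure of its interior (equivalently, of some open set). -/
def IsRegularlyClosed {X : Type u} [TopologicalSpace X] (C : Set X) : Prop :=
  closure (interior C) = C

/-- The axioms K2, K3, K4 for a non-negative function `ρ x C` of a point `x` and a regularly
closed set `C`. The values of `ρ` at sets that are not regularly closed are irrelevant. -/
structure KappaCore {X : Type u} [TopologicalSpace X] (ρ : X → Set X → ℝ≥0) : Prop where
  /-- K2: `ρ` is decreasing in the set. -/
  anti : ∀ C C' : Set X, IsRegularlyClosed C → IsRegularlyClosed C' → C ⊆ C' →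
    ∀ x, ρ x C' ≤ ρ x C
  /-- K3: `ρ` is continuous in the point. -/
  cont : ∀ C : Set X, IsRegularlyClosed C → Continuous fun x => ρ x C
  /-- K4: for increasing transfinite (that is, indexed by a non-empty well-ordered set) families
  of regularly closed sets, `ρ` at the closure of the union is the infimum. -/
  closure_iUnion : ∀ (ι : Type u) [LinearOrder ι] [WellFoundedLT ι] [Nonempty ι]
    (C : ι → Set X), (∀ i, IsRegularlyClosed (C i)) → Monotone C →
    ∀ x, ρ x (closure (⋃ i, C i)) = ⨅ i, ρ x (C i)

/-- A `κ`-metric: K1 (`ρ x C = 0` iff `x ∈ C`) and K2, K3, K4. -/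
structure IsKappaMetric {X : Type u} [TopologicalSpace X] (ρ : X → Set X → ℝ≥0) : Prop
    extends KappaCore ρ where
  eq_zero_iff : ∀ C : Set X, IsRegularlyClosed C → ∀ x, ρ x C = 0 ↔ x ∈ C

/-- A quasi `κ`-metric: K2, K3, K4, and for each regularly closed `C` there is a dense open
subset `V` of the complement of `C` such that `ρ x C > 0` iff `x ∈ V`. -/
structure IsQuasiKappaMetric {X : Type u} [TopologicalSpace X] (ρ : X → Set X → ℝ≥0) : Prop
    extends KappaCore ρ where
  exists_dense : ∀ C : Set X, IsRegularlyClosed C →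
    ∃ V : Set X, IsOpen V ∧ V ⊆ Cᶜ ∧ Cᶜ ⊆ closure V ∧ ∀ x, 0 < ρ x C ↔ x ∈ V

/-- K5, regularity. The supremum is taken in `[0, ∞]`. -/
def IsRegularKappa {X : Type u} [TopologicalSpace X] (ρ : X → Set X → ℝ≥0) : Prop :=
  ∀ C C' : Set X, IsRegularlyClosed C → IsRegularlyClosed C' → ∀ x,
    (ρ x C : ℝ≥0∞) ≤ (ρ x C' : ℝ≥0∞) + ⨆ y ∈ C', (ρ y C : ℝ≥0∞)

def KappaMetrizable (X : Type u) [TopologicalSpace X] : Prop :=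
  ∃ ρ : X → Set X → ℝ≥0, IsKappaMetric ρ

def QuasiKappaMetrizable (X : Type u) [TopologicalSpace X] : Prop :=
  ∃ ρ : X → Set X → ℝ≥0, IsQuasiKappaMetric ρ

def RegularlyQuasiKappaMetrizable (X : Type u) [TopologicalSpace X] : Prop :=
  ∃ ρ : X → Set X → ℝ≥0, IsQuasiKappaMetric ρ ∧ IsRegularKappa ρ

/-- `Z` together with `f : Z → X` is an absolute of `X`: `Z` is an extremally disconnected
Tychonoff space and `f` is a perfect irreducible surjection. (`IsProperMap` means continuous,
closed, with compact fibres.) -/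
structure IsAbsolute {Z X : Type u} [TopologicalSpace Z] [TopologicalSpace X] (f : Z → X) :
    Prop where
  tychonoff : T35Space Z
  extremallyDisconnected : ExtremallyDisconnected Z
  perfect : IsProperMap f
  surjective : Function.Surjective f
  irreducible : ∀ F : Set Z, IsClosed F → f '' F = univ → F = univ

/-! ### Regularly closed sets -/

/-! A closed irreducible surjection `f` sends regularly closed sets to regularly closed sets and
commutes with closures of unions, so `ρ (f z) (f '' C)` inherits K2–K5. Only K1 weakens: `f z ∈ f ''
C` may hold with `z ∉ C`, but irreducibility keeps such `z` nowhere dense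
(`IsQuasiKappaMetric.comap`).

Absolutes of compacta are minimal closed subsets of some `StoneCech S`, with `S` discrete, that
still map onto the compactum; the general case is a pullback along `X → StoneCech X`.

In an infinite extremally disconnected compactum, a cluster point of a sequence chosen from disjoint
open sets would, by K4 and K1, lie in the closures of two disjoint open sets, which is impossible.
The absolute of an interval then separates the two classes. -/

theorem IsOpen.isRegularlyClosed_closure {X : Type u} [TopologicalSpace X] {U : Set X}
    (hU : IsOpen U) : IsRegularlyClosed (closure U) :=
  (closure_minimal interior_subset isClosed_closure).antisymm
    (closure_mono (interior_maximal subset_closure hU))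

theorem IsRegularlyClosed.isClosed {X : Type u} [TopologicalSpace X] {C : Set X}
    (hC : IsRegularlyClosed C) : IsClosed C := by
  rw [← show closure (interior C) = C from hC]
  exact isClosed_closure

theorem isRegularlyClosed_closure_iUnion {X : Type u} [TopologicalSpace X] {ι : Type*}
    {C : ι → Set X} (hC : ∀ i, IsRegularlyClosed (C i)) :
    IsRegularlyClosed (closure (⋃ i, C i)) := by
  have : closure (⋃ i, C i) = closure (⋃ i, interior (C i)) := by
    refine (closure_minimal (iUnion_subset fun i => ?_) isClosed_closure).antisymm
      (closure_mono (iUnion_mono fun i => interior_subset))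
    rw [← show closure (interior (C i)) = C i from hC i]
    exact closure_mono (subset_iUnion (fun i => interior (C i)) i)
  rw [this]
  exact (isOpen_iUnion fun i => isOpen_interior).isRegularlyClosed_closure

/-! ### Irreducible closed maps -/

section Irreducible

variable {Z X : Type u} [TopologicalSpace Z] [TopologicalSpace X] {f : Z → X}

theorem IsClosedMap.exists_open_preimage_subset (hcl : IsClosedMap f)
    (hirr : ∀ F : Set Z, IsClosed F → f '' F = univ → F = univ)
    {U : Set Z} (hU : IsOpen U) (hne : U.Nonempty) :
    ∃ V : Set X, IsOpen V ∧ V.Nonempty ∧ f ⁻¹' V ⊆ U := by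
  refine ⟨(f '' Uᶜ)ᶜ, (hcl _ hU.isClosed_compl).isOpen_compl, ?_, fun z hz => ?_⟩
  · rw [nonempty_compl]
    intro h
    exact (compl_ne_univ.mpr hne) (hirr _ hU.isClosed_compl h)
  · by_contra hzU
    exact hz ⟨z, hzU, rfl⟩

/-- Density pulls back along `f`: any nonempty open set upstairs contains a full preimage of a
nonempty open set, where density downstairs applies. -/
theorem IsClosedMap.preimage_subset_closure_preimage (hcl : IsClosedMap f) (hc : Continuous f)
    (hs : Function.Surjective f) (hirr : ∀ F : Set Z, IsClosed F → f '' F = univ → F = univ)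
    {V W : Set X} (hW : IsOpen W) (hVW : W ⊆ closure V) : f ⁻¹' W ⊆ closure (f ⁻¹' V) := by
  intro z hz
  rw [mem_closure_iff]
  intro N hN hzN
  obtain ⟨V', hV', ⟨v, hv⟩, hsub⟩ :=
    hcl.exists_open_preimage_subset hirr (hN.inter (hW.preimage hc)) ⟨z, hzN, hz⟩
  have hvW : v ∈ W := by
    obtain ⟨y, rfl⟩ := hs v
    exact (hsub hv).2
  obtain ⟨w, hwV', hwV⟩ := mem_closure_iff.1 (hVW hvW) V' hV' hv
  obtain ⟨y, rfl⟩ := hs w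
  exact ⟨y, (hsub hwV').1, hwV⟩

/-- This is the source of the dense open set in K1*: the points outside `C` that share a fibre with
`C` contain no nonempty open set. -/
theorem IsClosedMap.compl_subset_closure_preimage_compl_image (hcl : IsClosedMap f)
    (hs : Function.Surjective f) (hirr : ∀ F : Set Z, IsClosed F → f '' F = univ → F = univ)
    {C : Set Z} (hC : IsClosed C) : Cᶜ ⊆ closure (f ⁻¹' (f '' C)ᶜ) := by
  intro z hz
  rw [mem_closure_iff]
  intro N hN hzN
  obtain ⟨V, hV, ⟨v, hv⟩, hsub⟩ :=
    hcl.exists_open_preimage_subset hirr (hN.inter hC.isOpen_compl) ⟨z, hzN, hz⟩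
  obtain ⟨y, rfl⟩ := hs v
  refine ⟨y, (hsub hv).1, ?_⟩
  rintro ⟨c, hc, hcy⟩
  exact (hsub (show f c ∈ V from hcy ▸ hv)).2 hc

theorem IsRegularlyClosed.image (hcl : IsClosedMap f) (hc : Continuous f)
    (hs : Function.Surjective f) (hirr : ∀ F : Set Z, IsClosed F → f '' F = univ → F = univ)
    {C : Set Z} (hC : IsRegularlyClosed C) : IsRegularlyClosed (f '' C) := by
  refine (closure_minimal interior_subset (hcl _ hC.isClosed)).antisymm ?_
  -- The points whose whole fibre lies in `interior C` form an open subset of `f '' C`;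
  -- irreducibility makes it dense there.
  have hopen : IsOpen (f '' (interior C)ᶜ)ᶜ := (hcl _ isOpen_interior.isClosed_compl).isOpen_compl
  have hsub : (f '' (interior C)ᶜ)ᶜ ⊆ f '' C := by
    intro x hx
    obtain ⟨z, rfl⟩ := hs x
    refine ⟨z, ?_, rfl⟩
    by_contra hz
    exact hx ⟨z, fun h => hz (interior_subset h), rfl⟩
  calc f '' C = f '' closure (interior C) := by rw [show closure (interior C) = C from hC]
    _ ⊆ closure (f '' interior C) := image_closure_subset_closure_image hc
    _ ⊆ closure (closure (f '' (interior C)ᶜ)ᶜ) :=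
        closure_mono (image_subset_closure_compl_image_compl_of_isOpen hc hs
          (fun E hE hEc h => hE (hirr E hEc h)) isOpen_interior)
    _ = closure (f '' (interior C)ᶜ)ᶜ := closure_closure
    _ ⊆ closure (interior (f '' C)) := closure_mono (interior_maximal hsub hopen)

theorem IsQuasiKappaMetric.comap {ρ : X → Set X → ℝ≥0} (hρ : IsQuasiKappaMetric ρ)
    (hcl : IsClosedMap f) (hc : Continuous f) (hs : Function.Surjective f)
    (hirr : ∀ F : Set Z, IsClosed F → f '' F = univ → F = univ) :
    IsQuasiKappaMetric fun (z : Z) (C : Set Z) => ρ (f z) (f '' C) where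
  anti C C' hC hC' h z :=
    hρ.anti _ _ (hC.image hcl hc hs hirr) (hC'.image hcl hc hs hirr) (image_mono h) (f z)
  cont C hC := (hρ.cont _ (hC.image hcl hc hs hirr)).comp hc
  closure_iUnion ι _ _ _ C hC hmono z := by
    rw [← hcl.closure_image_eq_of_continuous hc, image_iUnion]
    exact hρ.closure_iUnion ι _ (fun i => (hC i).image hcl hc hs hirr)
      (fun i j hij => image_mono (hmono hij)) (f z)
  exists_dense C hC := by
    obtain ⟨V, hV, hVC, hCV, hpos⟩ := hρ.exists_dense _ (hC.image hcl hc hs hirr)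
    refine ⟨f ⁻¹' V, hV.preimage hc, fun z hz hzC => hVC hz ⟨z, hzC, rfl⟩, ?_, fun z => hpos (f z)⟩
    refine (hcl.compl_subset_closure_preimage_compl_image hs hirr hC.isClosed).trans ?_
    exact closure_minimal
      (hcl.preimage_subset_closure_preimage hc hs hirr (hcl _ hC.isClosed).isOpen_compl hCV)
      isClosed_closure

theorem IsRegularKappa.comap {ρ : X → Set X → ℝ≥0} (hρ : IsRegularKappa ρ)
    (hcl : IsClosedMap f) (hc : Continuous f) (hs : Function.Surjective f)
    (hirr : ∀ F : Set Z, IsClosed F → f '' F = univ → F = univ) :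
    IsRegularKappa fun (z : Z) (C : Set Z) => ρ (f z) (f '' C) := by
  intro C C' hC hC' z
  have h := hρ _ _ (hC.image hcl hc hs hirr) (hC'.image hcl hc hs hirr) (f z)
  rwa [iSup_image] at h

end Irreducible

/-! ### Existence of absolutes -/

/-- A continuous self-map over an irreducible map from a Hausdorff space is the identity. -/
theorem eq_of_comp_eq_of_irreducible {E K : Type u} [TopologicalSpace E] [T2Space E] {p : E → K}
    (hirr : ∀ F : Set E, IsClosed F → p '' F = univ → F = univ) (hs : Function.Surjective p)
    {g : E → E} (hg : Continuous g) (hpg : ∀ e, p (g e) = p e) (e : E) : g e = e := by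
  by_contra hne
  obtain ⟨V, U, hV, hU, heV, heU, hd⟩ := t2_separation hne
  have hW : IsOpen (U ∩ g ⁻¹' V) := hU.inter (hV.preimage hg)
  -- A point `y` of the removed set has the twin `g y` in its fibre, and `g y ∈ V` lies outside `U`,
  -- so the complement still maps onto `K`.
  have huniv : (U ∩ g ⁻¹' V)ᶜ = univ := by
    refine hirr _ hW.isClosed_compl (eq_univ_of_forall fun k => ?_)
    obtain ⟨y, rfl⟩ := hs k
    by_cases hy : y ∈ U ∩ g ⁻¹' V
    · exact ⟨g y, fun h => disjoint_left.1 hd hy.2 h.1, hpg y⟩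
    · exact ⟨y, hy, rfl⟩
  exact (huniv ▸ mem_univ e : e ∈ (U ∩ g ⁻¹' V)ᶜ) ⟨heU, heV⟩

theorem ExtremallyDisconnected.of_retract {D E : Type*} [TopologicalSpace D] [TopologicalSpace E]
    [ExtremallyDisconnected D] {i : E → D} {r : D → E} (hi : Continuous i) (hr : Continuous r)
    (hri : ∀ e, r (i e) = e) : ExtremallyDisconnected E where
  open_closure U hU := by
    have : closure U = i ⁻¹' closure (r ⁻¹' U) := by
      apply Subset.antisymm
      · refine closure_minimal (fun e he => subset_closure ?_) (isClosed_closure.preimage hi)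
        simpa [hri] using he
      · intro e he
        have := hr.closure_preimage_subset U he
        simpa [hri] using this
    rw [this]
    exact (ExtremallyDisconnected.open_closure _ (hU.preimage hr)).preimage hi

theorem ExtremallyDisconnected.of_isDenseEmbedding {Z E : Type*} [TopologicalSpace Z]
    [TopologicalSpace E] [ExtremallyDisconnected E] {j : Z → E} (hj : IsDenseEmbedding j) :
    ExtremallyDisconnected Z where
  open_closure U hU := by
    obtain ⟨V, hV, rfl⟩ := hj.isOpen_iff.1 hU
    have hVd : closure (V ∩ range j) = closure V :=
      (closure_mono inter_subset_left).antisymm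
        (closure_minimal (hj.dense.open_subset_closure_inter hV) isClosed_closure)
    have : closure (j ⁻¹' V) = j ⁻¹' closure V := by
      rw [hj.isInducing.closure_eq_preimage_closure_image, image_preimage_eq_inter_range,
        hVd]
    rw [this]
    exact (ExtremallyDisconnected.open_closure _ hV).preimage hj.continuous

/-- Hides the carrier, so that the discrete topology does not clash with the given one on `K`. -/
theorem exists_discreteTopology_surjective (K : Type u) :
    ∃ (S : Type u) (_ : TopologicalSpace S) (_ : DiscreteTopology S) (s : S → K),
      Function.Surjective s :=
  ⟨K, ⊥, @DiscreteTopology.mk K ⊥ rfl, id, Function.surjective_id⟩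

theorem exists_isAbsolute_of_compact (K : Type u) [TopologicalSpace K] [CompactSpace K]
    [T2Space K] : ∃ (E : Type u) (_ : TopologicalSpace E) (p : E → K),
      CompactSpace E ∧ IsAbsolute p := by
  obtain ⟨S, _, _, s, hs⟩ := exists_discreteTopology_surjective K
  have hsc : Continuous s := continuous_of_discreteTopology
  let q : StoneCech S → K := stoneCechExtend hsc
  have hqc : Continuous q := continuous_stoneCechExtend hsc
  have hqs : Function.Surjective q := fun k => by
    obtain ⟨t, rfl⟩ := hs k
    exact ⟨stoneCechUnit t, congrFun (stoneCechExtend_extends hsc) t⟩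
  have hproj : CompactT2.Projective (StoneCech S) := StoneCech.projective
  have : ExtremallyDisconnected (StoneCech S) := hproj.extremallyDisconnected
  obtain ⟨E, hE, hEs, hEirr⟩ := exists_compact_surjective_zorn_subset hqc hqs
  let p : E → K := fun e => q e
  have hpc : Continuous p := hqc.comp continuous_subtype_val
  have hps : Function.Surjective p := fun k => by
    obtain ⟨d, hd, rfl⟩ := (hEs ▸ mem_univ k : k ∈ q '' E)
    exact ⟨⟨d, hd⟩, rfl⟩
  have hirr : ∀ F : Set E, IsClosed F → p '' F = univ → F = univ := fun F hF h => by
    by_contra hne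
    exact hEirr F hne hF h
  -- Projectivity lifts `q` through `p`. On `E` the lift lies over `p`, so irreducibility forces it
  -- to be the identity: `E` is a retract.
  obtain ⟨r, hr, hpr⟩ := hproj hqc hpc hps
  refine ⟨E, inferInstance, p, hE, inferInstance, ?_, hpc.isProperMap, hps, hirr⟩
  exact .of_retract continuous_subtype_val hr fun e =>
    eq_of_comp_eq_of_irreducible hirr hps (hr.comp continuous_subtype_val)
      (fun e => congrFun hpr e) e

theorem exists_isAbsolute (X : Type u) [TopologicalSpace X] [T35Space X] :
    ∃ (Z : Type u) (_ : TopologicalSpace Z) (f : Z → X), IsAbsolute f := by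
  obtain ⟨E, _, p, _, hp⟩ := exists_isAbsolute_of_compact (StoneCech X)
  have := hp.tychonoff
  have := hp.extremallyDisconnected
  have hpc := hp.perfect.continuous
  have hpcl := hp.perfect.isClosedMap
  have hemb : IsEmbedding (stoneCechUnit : X → StoneCech X) := isEmbedding_stoneCechUnit
  -- The pullback of `p` along `X → StoneCech X`.
  let T : Set (E × X) := {t | p t.1 = stoneCechUnit t.2}
  have hT : IsClosed T :=
    isClosed_eq (hpc.comp continuous_fst) (hemb.continuous.comp continuous_snd)
  let j : T → E := fun t => t.1.1
  let f : T → X := fun t => t.1.2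
  have hjc : Continuous j := continuous_fst.comp continuous_subtype_val
  have hfc : Continuous f := continuous_snd.comp continuous_subtype_val
  have hcomm : ∀ t : T, p (j t) = stoneCechUnit (f t) := fun t => t.2
  have hlift : ∀ e x, p e = stoneCechUnit x → ∃ t : T, j t = e ∧ f t = x :=
    fun e x h => ⟨⟨(e, x), h⟩, rfl, rfl⟩
  have hfs : Function.Surjective f := fun x => by
    obtain ⟨e, he⟩ := hp.surjective (stoneCechUnit x)
    obtain ⟨t, -, ht⟩ := hlift e x he
    exact ⟨t, ht⟩
  -- Used twice: `F = univ` gives density of `T` in `E`, closed `F` gives irreducibility of `f`.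
  have hdense : ∀ F : Set T, f '' F = univ → closure (j '' F) = univ := by
    intro F hF
    refine hp.irreducible _ isClosed_closure ?_
    refine (hpcl _ isClosed_closure).closure_eq ▸ Dense.closure_eq ?_
    refine denseRange_stoneCechUnit.mono ?_
    rintro _ ⟨x, rfl⟩
    obtain ⟨t, ht, rfl⟩ := (hF ▸ mem_univ x : x ∈ f '' F)
    exact ⟨j t, subset_closure ⟨t, ht, rfl⟩, hcomm t⟩
  -- The first coordinate determines the second continuously, since `X` embeds in `StoneCech X`.
  have hjind : IsInducing j := by
    refine ⟨?_⟩
    change instTopologicalSpaceSubtype = _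
    apply le_antisymm hjc.le_induced
    have hfi : Continuous[TopologicalSpace.induced j inferInstance, _] f := by
      let _ : TopologicalSpace T := TopologicalSpace.induced j inferInstance
      have hj' : Continuous j := continuous_induced_dom
      rw [hemb.continuous_iff]
      have : stoneCechUnit ∘ f = p ∘ j := funext fun t => (hcomm t).symm
      rw [this]
      exact hpc.comp hj'
    have hboth : Continuous[TopologicalSpace.induced j inferInstance, _]
        (Subtype.val : T → E × X) := by
      let _ : TopologicalSpace T := TopologicalSpace.induced j inferInstance
      exact (continuous_induced_dom (f := j)).prodMk hfi
    exact hboth.le_induced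
  have hjinj : Function.Injective j := by
    intro a b hab
    have : f a = f b := hemb.injective (by rw [← hcomm, ← hcomm, hab])
    exact Subtype.ext (Prod.ext hab this)
  have hjd : IsDenseEmbedding j :=
    { toIsInducing := hjind
      dense := by
        rw [DenseRange, dense_iff_closure_eq, ← image_univ]
        exact hdense univ (image_univ_of_surjective hfs)
      injective := hjinj }
  refine ⟨T, inferInstance, f, inferInstance, .of_isDenseEmbedding hjd,
    isProperMap_snd_of_compactSpace.comp hT.isProperMap_subtypeVal, hfs, ?_⟩
  intro F hF h
  rw [← hF.closure_eq, hjind.closure_eq_preimage_closure_image, hdense F h, preimage_univ]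

/-! ### Extremally disconnected compacta are not `κ`-metrizable -/

/-- Infinite extremally disconnected compact Hausdorff spaces are not `κ`-metrizable. -/
theorem not_kappaMetrizable_of_extremallyDisconnected (Z : Type u) [TopologicalSpace Z]
    [CompactSpace Z] [T2Space Z] [Infinite Z] [ExtremallyDisconnected Z] :
    ¬ KappaMetrizable Z := by
  rintro ⟨ρ, hρ⟩
  obtain ⟨U, hUinf, hUo, hUd⟩ := exists_seq_infinite_isOpen_pairwise_disjoint Z
  choose u hu using fun n => (hUinf n).nonempty
  obtain ⟨x, hx⟩ : ∃ x, MapClusterPt x Filter.atTop u :=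
    exists_clusterPt_of_compactSpace (Filter.map u Filter.atTop)
  let B : ℕ → ℕ → Set Z := fun m n => ⋃ i ∈ Ico m n, U i
  have hBo : ∀ m n, IsOpen (B m n) := fun m n => isOpen_biUnion fun i _ => hUo i
  have hB : ∀ m n, IsRegularlyClosed (closure (B m n)) :=
    fun m n => (hBo m n).isRegularlyClosed_closure
  -- The tail from `m` on still clusters at `x`, so K1 and K4 make the infimum over its finite
  -- blocks zero.
  have hsmall : ∀ m k : ℕ, ∃ n, m < n ∧ ρ x (closure (B m n)) < 1 / ((k : ℝ≥0) + 1) := by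
    intro m k
    -- `ULift` puts the index type in the universe required by K4.
    have hmono : Monotone fun n : ULift.{u} ℕ => closure (B m n.down) := fun a b hab =>
      closure_mono (biUnion_subset_biUnion_left (Ico_subset_Ico_right hab))
    have hinf := hρ.closure_iUnion (ULift.{u} ℕ) (fun n => closure (B m n.down))
      (fun n => hB m n.down) hmono x
    have hmem : x ∈ closure (⋃ n : ULift.{u} ℕ, closure (B m n.down)) := by
      refine mem_closure_iff_clusterPt.2 (ClusterPt.mono hx ?_)
      refine Filter.le_principal_iff.2 (Filter.mem_map.2 ?_)
      filter_upwards [Filter.eventually_ge_atTop m] with i hi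
      exact mem_iUnion.2 ⟨⟨i + 1⟩, subset_closure (mem_iUnion₂.2 ⟨i, ⟨hi, i.lt_succ_self⟩, hu i⟩)⟩
    rw [(hρ.eq_zero_iff _ (isRegularlyClosed_closure_iUnion fun n : ULift.{u} ℕ => hB m n.down)
      x).2 hmem] at hinf
    have hlt : ⨅ n : ULift.{u} ℕ, ρ x (closure (B m n.down)) < 1 / ((k : ℝ≥0) + 1) := by
      rw [← hinf]; positivity
    obtain ⟨n, hn⟩ := exists_lt_of_ciInf_lt hlt
    refine ⟨max n.down (m + 1), by omega, lt_of_le_of_lt ?_ hn⟩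
    exact hρ.anti _ _ (hB _ _) (hB _ _) (hmono (a := n) (b := ⟨max n.down (m + 1)⟩)
      (le_max_left _ _)) x
  choose next hnext_lt hnext using hsmall
  let a : ℕ → ℕ := fun k => Nat.rec 0 (fun k m => next m k) k
  have ha : ∀ k, a (k + 1) = next (a k) k := fun k => rfl
  have ha_mono : StrictMono a := strictMono_nat_of_lt_succ fun k => by
    rw [ha]; exact hnext_lt _ _
  have hblock : ∀ k, ρ x (closure (B (a k) (a (k + 1)))) < 1 / ((k : ℝ≥0) + 1) := fun k => by
    rw [ha]; exact hnext _ _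
  -- Only `c = 0` and `c = 1` are used: the unions of the even and of the odd blocks.
  let A : ℕ → Set Z := fun c => ⋃ l : ℕ, B (a (2 * l + c)) (a (2 * l + c + 1))
  have hAo : ∀ c, IsOpen (A c) := fun c => isOpen_iUnion fun l => hBo _ _
  have hxA : ∀ c, x ∈ closure (A c) := by
    intro c
    rw [← hρ.eq_zero_iff _ (hAo c).isRegularlyClosed_closure]
    by_contra hne
    obtain ⟨l, hl⟩ := exists_nat_one_div_lt (pos_iff_ne_zero.2 hne)
    refine lt_irrefl (ρ x (closure (A c))) ?_
    calc ρ x (closure (A c)) ≤ ρ x (closure (B (a (2 * l + c)) (a (2 * l + c + 1)))) :=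
          hρ.anti _ _ (hB _ _) (hAo c).isRegularlyClosed_closure
            (closure_mono (subset_iUnion
              (fun l : ℕ => B (a (2 * l + c)) (a (2 * l + c + 1))) l)) x
      _ ≤ 1 / (((2 * l + c : ℕ) : ℝ≥0) + 1) := (hblock _).le
      _ ≤ 1 / ((l : ℝ≥0) + 1) := by
          apply one_div_le_one_div_of_le (by positivity)
          have : l ≤ 2 * l + c := by omega
          gcongr
      _ < ρ x (closure (A c)) := hl
  have hdisj : Disjoint (A 0) (A 1) := by
    rw [disjoint_left]
    intro z hz hz'
    obtain ⟨l, hl⟩ := mem_iUnion.1 hz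
    obtain ⟨i, hi, hzi⟩ := mem_iUnion₂.1 hl
    obtain ⟨l', hl'⟩ := mem_iUnion.1 hz'
    obtain ⟨i', hi', hzi'⟩ := mem_iUnion₂.1 hl'
    have hii : i = i' := by
      by_contra hne
      exact disjoint_left.1 (hUd hne) hzi hzi'
    subst hii
    have h1 : 2 * l + 0 < 2 * l' + 1 + 1 := ha_mono.lt_iff_lt.1 (hi.1.trans_lt hi'.2)
    have h2 : 2 * l' + 1 < 2 * l + 0 + 1 := ha_mono.lt_iff_lt.1 (hi'.1.trans_lt hi.2)
    omega
  exact disjoint_left.1 (ExtremallyDisconnected.disjoint_closure_of_disjoint_isOpen hdisj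
    (hAo 0) (hAo 1)) (hxA 0) (hxA 1)

/-! ### `κ`-metrizable spaces -/

theorem KappaMetrizable.quasiKappaMetrizable {X : Type u} [TopologicalSpace X]
    (h : KappaMetrizable X) : QuasiKappaMetrizable X := by
  obtain ⟨ρ, hρ⟩ := h
  refine ⟨ρ, hρ.toKappaCore, fun C hC => ⟨Cᶜ, hC.isClosed.isOpen_compl, Subset.rfl,
    subset_closure, fun x => ?_⟩⟩
  rw [pos_iff_ne_zero, Ne, hρ.eq_zero_iff C hC, mem_compl_iff]

/-- Metric spaces are `κ`-metrizable: take the distance to a set, truncated at `1`. -/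
theorem kappaMetrizable_of_pseudoEMetricSpace (X : Type u) [PseudoEMetricSpace X] :
    KappaMetrizable X := by
  -- Without truncation the value could be `⊤`, for instance at `C = ∅`, and `toNNReal` would turn
  -- it into `0`, breaking K1.
  have hfin : ∀ (x : X) (C : Set X), min 1 (Metric.infEDist x C) ≠ ⊤ :=
    fun x C => ne_top_of_le_ne_top ENNReal.one_ne_top (min_le_left _ _)
  refine ⟨fun x C => (min 1 (Metric.infEDist x C)).toNNReal, ⟨?_, ?_, ?_⟩, ?_⟩
  · intro C C' _ _ h x
    exact ENNReal.toNNReal_mono (hfin x C) (min_le_min_left _ (Metric.infEDist_anti h))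
  · intro C _
    exact ENNReal.continuousOn_toNNReal.comp_continuous
      (continuous_const.min Metric.continuous_infEDist) (fun x => hfin x C)
  · intro ι _ _ _ C _ _ x
    rw [Metric.infEDist_closure, Metric.infEDist_iUnion, inf_iInf,
      ENNReal.toNNReal_iInf fun i => hfin x (C i)]
  · intro C hC x
    have h1 : min 1 (Metric.infEDist x C) = 0 ↔ Metric.infEDist x C = 0 := by simp
    rw [ENNReal.toNNReal_eq_zero_iff, or_iff_left (hfin x C), h1,
      ← Metric.mem_closure_iff_infEDist_zero, hC.isClosed.closure_eq]

theorem IsAbsolute.quasiKappaMetrizable {X Z : Type u} [TopologicalSpace X] [TopologicalSpace Z]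
    {f : Z → X} (hf : IsAbsolute f) (h : QuasiKappaMetrizable X) : QuasiKappaMetrizable Z :=
  let ⟨_, hρ⟩ := h
  ⟨_, hρ.comap hf.perfect.isClosedMap hf.perfect.continuous hf.surjective hf.irreducible⟩

theorem IsAbsolute.not_kappaMetrizable {X Z : Type u} [TopologicalSpace X] [TopologicalSpace Z]
    [CompactSpace X] [Infinite X] {f : Z → X} (hf : IsAbsolute f) : ¬ KappaMetrizable Z := by
  have := hf.tychonoff
  have := hf.extremallyDisconnected
  have : Infinite Z := Infinite.of_surjective f hf.surjective
  have : CompactSpace Z := ⟨by simpa using hf.perfect.isCompact_preimage isCompact_univ⟩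
  exact not_kappaMetrizable_of_extremallyDisconnected Z

theorem corollary3p7 :
    -- every Tychonoff space has an absolute
    (∀ (X : Type u) [TopologicalSpace X] [T35Space X],
      ∃ (Z : Type u) (_ : TopologicalSpace Z) (f : Z → X), IsAbsolute f) ∧
    -- the absolute of a (regularly) quasi κ-metrizable space is (regularly) quasi κ-metrizable
    (∀ (X Z : Type u) [TopologicalSpace X] [TopologicalSpace Z] [T35Space X] (f : Z → X),
      IsAbsolute f →
        (QuasiKappaMetrizable X → QuasiKappaMetrizable Z) ∧
        (RegularlyQuasiKappaMetrizable X → RegularlyQuasiKappaMetrizable Z)) ∧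
    -- the absolute of an infinite κ-metrizable compactum is quasi κ-metrizable, not κ-metrizable
    (∀ (X Z : Type u) [TopologicalSpace X] [TopologicalSpace Z] [T35Space X] [CompactSpace X]
      [Infinite X] (f : Z → X), IsAbsolute f → KappaMetrizable X →
        QuasiKappaMetrizable Z ∧ ¬ KappaMetrizable Z) ∧
    -- the κ-metrizable spaces form a proper subclass of the quasi κ-metrizable spaces
    (∀ (X : Type u) [TopologicalSpace X] [T35Space X],
      KappaMetrizable X → QuasiKappaMetrizable X) ∧
    (∃ (X : Type u) (_ : TopologicalSpace X), T35Space X ∧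
      QuasiKappaMetrizable X ∧ ¬ KappaMetrizable X) := by
  refine ⟨fun X _ _ => exists_isAbsolute X, fun X Z _ _ _ f hf =>
    ⟨hf.quasiKappaMetrizable, ?_⟩, fun X Z _ _ _ _ _ f hf hX =>
    ⟨hf.quasiKappaMetrizable hX.quasiKappaMetrizable, hf.not_kappaMetrizable⟩,
    fun X _ _ h => h.quasiKappaMetrizable, ?_⟩
  · rintro ⟨ρ, hρ, hreg⟩
    have hcl := hf.perfect.isClosedMap
    have hc := hf.perfect.continuous
    exact ⟨_, hρ.comap hcl hc hf.surjective hf.irreducible,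
      hreg.comap hcl hc hf.surjective hf.irreducible⟩
  · have : Infinite unitInterval := (Icc_infinite zero_lt_one).to_subtype
    have : Infinite (ULift.{u} unitInterval) := Infinite.of_injective _ ULift.up_injective
    obtain ⟨Z, _, f, hf⟩ := exists_isAbsolute (ULift.{u} unitInterval)
    exact ⟨Z, inferInstance, hf.tychonoff,
      hf.quasiKappaMetrizable (kappaMetrizable_of_pseudoEMetricSpace _).quasiKappaMetrizable,
      hf.not_kappaMetrizable⟩
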